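/- Let $\Sigma$ be a finite alphabet. Inputs $w\in\Sigma^*$ are written on a tape as $\cent\, w\,\$$, with end-markers $\cent,\$\notin\Sigma$; put $\Gamma=\Sigma\cup\{\cent,\$\}$. A probabilistic finite automaton (PFA) $\mathcal P$ consists of a finite set of states with a designated start state, a real (row-)stochastic transition matrix $A_\sigma$ for every $\sigma\in\Gamma$, and a set $F$ of accepting states. Its acceptance probability is $f_{\mathcal P}(w)=\sum_{i\in F}\big(v_0A_{\cent}A_{w_1}\cdots A_{w_{|w|}}A_{\$}\big)(i)$, where the row vector $v_0$ is the indicator of the start state. Let $\mathrm{S}^{=}$ be the class of all languages of the form $\{w\in\Sigma^*: f_{\mathcal P}(w)=\lambda\}$ with $\mathcal P$ a PFA and $\lambda\in[0,1]$. A Kondacs–Watrous quantum finite automaton (KWQFA) $\mathcal M$ consists of a finite set $Q$ of states with a designated start state, a complex unitary matrix $U_\sigma$ for every $\sigma\in\Gamma$, and disjoint sets $Q_{acc},Q_{rej}\subseteq Q$ of accepting and rejecting states. Starting from the indicator vector of the start state, $\mathcal M$ scans $\cent\,w\,\$$ from left to right; for each scanned symbol $\sigma$ the state vector $u$ is replaced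 by $U_\sigma u$, then $\sum_{q\in Q_{acc}}|(U_\sigma u)(q)|^2$ is added to the acceptance probability, and then the amplitudes of all states in $Q_{acc}\cup Q_{rej}$ are replaced by $0$. Let $f_{\mathcal M}(w)$ be the acceptance probability accumulated in this way. $\mathcal M$ recognizes a language $L$ with negative one-sided error if $L=\{w\in\Sigma^*: f_{\mathcal M}(w)=1\}$, that is, members are accepted with certainty and every nonmember is accepted with probability less than $1$. Then $\mathrm{S}^{=}$ is precisely the class of languages over $\Sigma$ that can be recognized with negative one-sided error by KWQFAs. -/

import Mathlib

open scoped Matrix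

/-- The tape alphabet: the input letters together with the left and right end-markers. -/
inductive TapeSymbol (α : Type*) where
  | leftEnd : TapeSymbol α
  | letter (a : α) : TapeSymbol α
  | rightEnd : TapeSymbol α

/-- The tape content for the input `w`: left end-marker, then `w`, then right end-marker. -/
def tape {α : Type*} (w : List α) : List (TapeSymbol α) :=
  TapeSymbol.leftEnd :: (w.map TapeSymbol.letter ++ [TapeSymbol.rightEnd])

/-- The language of all words on which the (acceptance probability) function `f` takes exactly
the value `c`. -/
def eqCutLanguage {α : Type*} (f : List α → ℝ) (c : ℝ) : Language α :=
  {w : List α | f w = c}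

/-- A one-way probabilistic finite automaton over the input alphabet `α` with finite state set `S`.
`trans σ i j` is the probability of moving from state `i` to state `j` when reading `σ`;
the matrices are row-stochastic. -/
structure PFA (α S : Type*) [Fintype S] [DecidableEq S] where
  start : S
  trans : TapeSymbol α → Matrix S S ℝ
  trans_stochastic : ∀ σ, trans σ ∈ Matrix.rowStochastic ℝ S
  accept : Finset S

namespace PFA

variable {α S : Type*} [Fintype S] [DecidableEq S]

/-- The final distribution (a row vector) after reading the tape symbols `x` from
distribution `v`. -/
def evalFrom (P : PFA α S) (v : S → ℝ) (x : List (TapeSymbol α)) : S → ℝ :=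
  x.foldl (fun v σ => v ᵥ* P.trans σ) v

/-- The acceptance probability of the input `w`. -/
def acceptProb (P : PFA α S) (w : List α) : ℝ :=
  ∑ i ∈ P.accept, P.evalFrom (Pi.single P.start 1) (tape w) i

end PFA

/-- A one-way Kondacs-Watrous quantum finite automaton over the input alphabet `α` with finite
state set `Q`. `trans σ j i` is the amplitude of the transition from state `i` to state `j` when
reading `σ`. -/
structure KWQFA (α Q : Type*) [Fintype Q] [DecidableEq Q] where
  start : Q
  trans : TapeSymbol α → Matrix Q Q ℂ
  trans_unitary : ∀ σ, trans σ ∈ Matrix.unitaryGroup Q ℂ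
  accept : Finset Q
  reject : Finset Q
  disjoint_accept_reject : Disjoint accept reject

namespace KWQFA

variable {α Q : Type*} [Fintype Q] [DecidableEq Q]

/-- The halting states drop out of the state vector: their amplitudes are replaced by zero. -/
def dropHalting (M : KWQFA α Q) (u : Q → ℂ) : Q → ℂ :=
  fun q => if q ∈ M.accept ∪ M.reject then 0 else u q

/-- The total probability of acceptance while scanning the tape symbols `x` from the
(unnormalized) state vector `u`: for each symbol the state vector evolves unitarily, every
accepting state of amplitude `a` contributes `|a|²`, and the halting states then drop out. -/
noncomputable def acceptProbFrom (M : KWQFA α Q) : (Q → ℂ) → List (TapeSymbol α) → ℝ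
  | _, [] => 0
  | u, σ :: x =>
      (∑ q ∈ M.accept, ‖(M.trans σ *ᵥ u) q‖ ^ 2) +
        M.acceptProbFrom (M.dropHalting (M.trans σ *ᵥ u)) x

/-- The overall acceptance probability of the input `w`. -/
noncomputable def acceptProb (M : KWQFA α Q) (w : List α) : ℝ :=
  M.acceptProbFrom (Pi.single M.start 1) (tape w)

/-- `M` recognizes `L` with negative one-sided error: the members of `L` are exactly the words
which `M` accepts with certainty, so every nonmember fails to be accepted with nonzero
probability. -/
def RecognizesWithNegativeOneSidedError (M : KWQFA α Q) (L : Language α) : Prop :=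
  L = eqCutLanguage M.acceptProb 1

end KWQFA

/-- The class `S⁼` over the alphabet `α`: the languages of all words accepted with probability
exactly `c`, for a probabilistic finite automaton and a number `c ∈ [0, 1]`. -/
def SEq (α : Type*) : Set (Language α) :=
  {L | ∃ (S : Type) (_ : Fintype S) (_ : DecidableEq S) (P : PFA α S) (c : ℝ),
    c ∈ Set.Icc (0 : ℝ) 1 ∧ L = eqCutLanguage P.acceptProb c}

/-- The class of languages over `α` that are recognized with negative one-sided error by
Kondacs-Watrous quantum finite automata. -/
def KWQFANegativeOneSided (α : Type*) : Set (Language α) :=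
  {L | ∃ (Q : Type) (_ : Fintype Q) (_ : DecidableEq Q) (M : KWQFA α Q),
    M.RecognizesWithNegativeOneSidedError L}

/-!
Both classes coincide with the class of zero sets of real linear automata: the words `w` at which
an entry of `e M_¢ M_{w₁} ⋯ M_{wₖ} M_$` vanishes, for a unit row vector `e` and real square
matrices `M_σ` without any further restriction.

*Real automata are probabilistic ones* (`setOf_rowRun_eq_zero_mem_SEq`, Turakainen's construction).
Two copies of the index set, of signs `+` and `-`, represent a real vector as the difference of the
two halves of a distribution. The matrix whose entries are `1 / 2N ± ε M i j` is stochastic for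
small `ε`, since the signs cancel in every row, and it acts on differences as `2ε M`. So the
acceptance probability is `1 / 2N` plus a positive multiple of the entry under consideration, and
the cut point is `1 / 2N`. Conversely, subtracting the cut point from the acceptance vector turns a
probabilistic automaton into a real one.

*Quantum automata are real ones* (`KWQFA.setOf_acceptProb_eq_one_mem_SEq`). The pair of the
unnormalized density matrix and the acceptance probability accumulated so far evolves linearly over
`ℝ`, and starting the second component at `-1` makes `f w = 1` the vanishing of a linear functional.

*Real automata are quantum ones* (`setOf_rowRun_eq_zero_mem_KWQFANegativeOneSided`). A
sufficiently small positive multiple of any matrix is a corner of a unitary matrix of twice the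
size (`exists_unitary_corner`). Let the second half of the states be accepting and nothing be
rejecting: whatever leaves the simulation is accepted, so the word is accepted with probability one
minus the squared norm of the final vector of the simulation, which is a positive multiple of the
final vector of the real automaton.
-/

/-! ### Products of real matrices along a word -/

/-- The row vector reached from `v` by multiplying with the matrices `M σ` for the successive
symbols `σ` of `x`. -/
def rowRun {β n : Type*} [Fintype n] (M : β → Matrix n n ℝ) (v : n → ℝ) (x : List β) : n → ℝ :=
  x.foldl (fun v σ => v ᵥ* M σ) v

section rowRun

variable {β n : Type*} [Fintype n] (M : β → Matrix n n ℝ)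

@[simp] theorem rowRun_nil (v : n → ℝ) : rowRun M v [] = v := rfl

@[simp] theorem rowRun_cons (v : n → ℝ) (σ : β) (x : List β) :
    rowRun M v (σ :: x) = rowRun M (v ᵥ* M σ) x := rfl

theorem rowRun_concat (v : n → ℝ) (x : List β) (σ : β) :
    rowRun M v (x ++ [σ]) = rowRun M v x ᵥ* M σ := by
  simp [rowRun]

theorem exists_rowRun_smul_eq {c : β → ℝ} (hc : ∀ σ, 0 < c σ) (x : List β) :
    ∃ k : ℝ, 0 < k ∧ ∀ v, rowRun (fun σ => c σ • M σ) v x = k • rowRun M v x := by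
  induction x using List.reverseRecOn with
  | nil => exact ⟨1, one_pos, by simp⟩
  | append_singleton x σ ih =>
    obtain ⟨k, hk, h⟩ := ih
    refine ⟨c σ * k, mul_pos (hc σ) hk, fun v => ?_⟩
    simp only [rowRun_concat, h, Matrix.vecMul_smul, Matrix.smul_vecMul, smul_smul]

end rowRun

theorem tape_eq_concat {α : Type*} (w : List α) :
    tape w = (TapeSymbol.leftEnd :: w.map TapeSymbol.letter) ++ [TapeSymbol.rightEnd] := rfl

/-! ### Real automata are probabilistic automata with a cut point -/

section Turakainen

/-- The sign of a copy of the index set: `true` is the positive copy, `false` the negative one. -/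
def copySign (b : Bool) : ℝ := if b then 1 else -1

/-- The matrix on two signed copies of the index set that perturbs the uniform transition
probabilities by `± ε M i j`, with sign `+` within a copy and `-` between the copies. -/
noncomputable def signedDouble {n : Type*} [Fintype n] (ε : ℝ) (M : Matrix n n ℝ) :
    Matrix (Bool × n) (Bool × n) ℝ :=
  Matrix.of fun s t =>
    1 / (2 * Fintype.card n) + ε * (copySign s.1 * copySign t.1 * M s.2 t.2)

/-- The real vector represented by a vector on the two signed copies. -/
def copyDiff {n : Type*} (v : Bool × n → ℝ) : n → ℝ := fun j => v (true, j) - v (false, j)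

variable {n : Type*} [Fintype n]

theorem abs_copySign_mul (b b' : Bool) (r : ℝ) : |copySign b * copySign b' * r| = |r| := by
  cases b <;> cases b' <;> simp [copySign]

theorem signedDouble_mem_rowStochastic [DecidableEq n] [Nonempty n] {ε : ℝ} {M : Matrix n n ℝ}
    (hε : 0 ≤ ε) (h : ∀ i j, ε * |M i j| ≤ 1 / (2 * Fintype.card n)) :
    signedDouble ε M ∈ Matrix.rowStochastic ℝ (Bool × n) := by
  rw [Matrix.mem_rowStochastic_iff_sum]
  have hN : (Fintype.card n : ℝ) ≠ 0 := by simp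
  refine ⟨fun s t => ?_, fun s => ?_⟩
  · have h1 := neg_abs_le (copySign s.1 * copySign t.1 * M s.2 t.2)
    rw [abs_copySign_mul] at h1
    have h2 := mul_le_mul_of_nonneg_left h1 hε
    have h3 := h s.2 t.2
    simp only [signedDouble, Matrix.of_apply]
    linarith
  · simp only [signedDouble, Matrix.of_apply, Fintype.sum_prod_type, Fintype.sum_bool,
      ← Finset.sum_add_distrib]
    calc _ = ∑ _j : n, (1 / (Fintype.card n : ℝ)) := by
          refine Finset.sum_congr rfl fun j _ => ?_
          simp only [copySign]
          field_simp
          simp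
          ring
      _ = 1 := by simp [hN]

theorem exists_pos_mul_abs_le [Nonempty n] (M : Matrix n n ℝ) :
    ∃ ε : ℝ, 0 < ε ∧ ∀ i j, ε * |M i j| ≤ 1 / (2 * Fintype.card n) := by
  have hN : (0 : ℝ) < 1 / (2 * Fintype.card n) := by
    have : (0 : ℝ) < Fintype.card n := by exact_mod_cast Fintype.card_pos
    positivity
  have hS : 0 ≤ ∑ i, ∑ j, |M i j| := by positivity
  refine ⟨1 / (2 * Fintype.card n) / (1 + ∑ i, ∑ j, |M i j|), by positivity, fun i j => ?_⟩
  have h1 : |M i j| ≤ ∑ j, |M i j| :=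
    Finset.single_le_sum (f := fun j => |M i j|) (fun _ _ => abs_nonneg _) (Finset.mem_univ j)
  have h2 : ∑ j, |M i j| ≤ ∑ i, ∑ j, |M i j| :=
    Finset.single_le_sum (f := fun i => ∑ j, |M i j|)
      (fun _ _ => Finset.sum_nonneg fun _ _ => abs_nonneg _) (Finset.mem_univ i)
  rw [div_mul_eq_mul_div, div_le_iff₀ (by positivity)]
  exact mul_le_mul_of_nonneg_left (by linarith) hN.le

theorem vecMul_signedDouble_apply (ε : ℝ) (M : Matrix n n ℝ) (v : Bool × n → ℝ) (b : Bool)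
    (j : n) : (v ᵥ* signedDouble ε M) (b, j) =
      (∑ s, v s) / (2 * Fintype.card n) + copySign b * ε * (copyDiff v ᵥ* M) j := by
  simp only [Matrix.vecMul, dotProduct, signedDouble, Matrix.of_apply, Fintype.sum_prod_type,
    Fintype.sum_bool, copyDiff, ← Finset.sum_add_distrib, Finset.sum_div, Finset.mul_sum]
  refine Finset.sum_congr rfl fun i _ => ?_
  simp only [copySign, if_true]
  simp only [Bool.false_eq_true, if_false]
  ring

theorem copyDiff_vecMul_signedDouble (ε : ℝ) (M : Matrix n n ℝ) (v : Bool × n → ℝ) :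
    copyDiff (v ᵥ* signedDouble ε M) = copyDiff v ᵥ* ((2 * ε) • M) := by
  ext j
  rw [Matrix.vecMul_smul]
  simp only [copyDiff, vecMul_signedDouble_apply, Pi.smul_apply, smul_eq_mul]
  simp [copySign]
  ring

theorem copyDiff_rowRun_signedDouble {β : Type*} (ε : β → ℝ) (M : β → Matrix n n ℝ)
    (x : List β) (v : Bool × n → ℝ) :
    copyDiff (rowRun (fun σ => signedDouble (ε σ) (M σ)) v x) =
      rowRun (fun σ => (2 * ε σ) • M σ) (copyDiff v) x := by
  induction x generalizing v with
  | nil => rfl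
  | cons σ x ih => rw [rowRun_cons, rowRun_cons, ih, copyDiff_vecMul_signedDouble]

/-- Stochastic matrices preserve the total mass of a row vector. -/
theorem sum_rowRun_of_rowStochastic {β : Type*} [DecidableEq n] {A : β → Matrix n n ℝ}
    (hA : ∀ σ, A σ ∈ Matrix.rowStochastic ℝ n) (x : List β) (v : n → ℝ) :
    ∑ i, rowRun A v x i = ∑ i, v i := by
  induction x generalizing v with
  | nil => rfl
  | cons σ x ih =>
    rw [rowRun_cons, ih]
    simp only [Matrix.vecMul, dotProduct]
    rw [Finset.sum_comm]
    simp [← Finset.mul_sum, Matrix.sum_row_of_mem_rowStochastic (hA σ)]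

/-- The zero set of an arbitrary real automaton belongs to `S⁼`. -/
theorem setOf_rowRun_eq_zero_mem_SEq {α : Type*} {n : Type} [Fintype n] [DecidableEq n]
    (M : TapeSymbol α → Matrix n n ℝ) (i j : n) :
    ({w | rowRun M (Pi.single i 1) (tape w) j = 0} : Language α) ∈ SEq α := by
  have : Nonempty n := ⟨i⟩
  choose ε hε hM using fun σ => exists_pos_mul_abs_le (M σ)
  have hN : (1 : ℝ) ≤ Fintype.card n := by exact_mod_cast Fintype.card_pos
  let A : TapeSymbol α → Matrix (Bool × n) (Bool × n) ℝ := fun σ => signedDouble (ε σ) (M σ)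
  have hA : ∀ σ, A σ ∈ Matrix.rowStochastic ℝ (Bool × n) :=
    fun σ => signedDouble_mem_rowStochastic (hε σ).le (hM σ)
  refine ⟨Bool × n, inferInstance, inferInstance, ⟨(true, i), A, hA, {(true, j)}⟩,
    1 / (2 * Fintype.card n), ⟨by positivity, ?_⟩, ?_⟩
  · rw [div_le_one (by positivity)]
    linarith
  ext w
  change rowRun M (Pi.single i 1) (tape w) j = 0 ↔
    (∑ s ∈ {(true, j)}, rowRun A (Pi.single (true, i) 1) (tape w) s) = _
  have hd : copyDiff (Pi.single (true, i) (1 : ℝ) : Bool × n → ℝ) = Pi.single i 1 := by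
    ext k
    by_cases h : k = i <;> simp [copyDiff, h]
  obtain ⟨k, hk, hkM⟩ := exists_rowRun_smul_eq M (c := fun σ => 2 * ε σ)
    (fun σ => mul_pos two_pos (hε σ)) (TapeSymbol.leftEnd :: w.map TapeSymbol.letter)
  rw [Finset.sum_singleton, tape_eq_concat, rowRun_concat, rowRun_concat,
    vecMul_signedDouble_apply, sum_rowRun_of_rowStochastic hA, copyDiff_rowRun_signedDouble, hd,
    hkM, Matrix.smul_vecMul, Finset.sum_pi_single']
  simp [copySign, (hε _).ne', hk.ne']

/-- A coordinate-free form of `setOf_rowRun_eq_zero_mem_SEq`. -/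
theorem setOf_linear_eq_zero_mem_SEq {α : Type*} {V : Type} [AddCommGroup V] [Module ℝ V]
    [FiniteDimensional ℝ V] [Nontrivial V] (T : TapeSymbol α → V →ₗ[ℝ] V) (v : V)
    (l : V →ₗ[ℝ] ℝ) :
    ({w | l ((tape w).foldl (fun u σ => T σ u) v) = 0} : Language α) ∈ SEq α := by
  let b := Module.finBasis ℝ V
  obtain ⟨i⟩ : Nonempty (Fin (Module.finrank ℝ V)) := b.index_nonempty
  -- The rows at the left end-marker are all equal to the coordinates of the vector reached there,
  -- and the columns at the right end-marker to those of the functional, so that neither the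
  -- initial index nor the final one matters.
  let M : TapeSymbol α → Matrix (Fin (Module.finrank ℝ V)) (Fin (Module.finrank ℝ V)) ℝ
    | .leftEnd => Matrix.of fun _ j => b.repr (T .leftEnd v) j
    | .letter a => Matrix.of fun i j => b.repr (T (.letter a) (b i)) j
    | .rightEnd => Matrix.of fun i _ => l (T .rightEnd (b i))
  have hsum (f : V →ₗ[ℝ] ℝ) (u : V) : ∑ k, b.repr u k * f (b k) = f u := by
    conv_rhs => rw [← b.sum_repr u]
    simp only [map_sum, map_smul, smul_eq_mul]
  have hletters (w : List α) (u : V) : rowRun M (b.repr u) (w.map TapeSymbol.letter) =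
      b.repr ((w.map TapeSymbol.letter).foldl (fun u σ => T σ u) u) := by
    induction w generalizing u with
    | nil => rfl
    | cons a w ih =>
      rw [List.map_cons, rowRun_cons, List.foldl_cons, ← ih]
      congr 1
      ext j
      exact hsum (b.coord j ∘ₗ T (.letter a)) u
  refine Set.mem_of_eq_of_mem ?_ (setOf_rowRun_eq_zero_mem_SEq M i i)
  ext w
  have hleft : Pi.single i 1 ᵥ* M .leftEnd = b.repr (T .leftEnd v) := by
    rw [Matrix.single_one_vecMul]
    rfl
  have hright : l ((tape w).foldl (fun u σ => T σ u) v) =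
      rowRun M (Pi.single i 1) (tape w) i := by
    rw [tape_eq_concat, rowRun_concat, rowRun_cons, hleft, hletters, List.foldl_append]
    exact (hsum (l ∘ₗ T .rightEnd) _).symm
  exact Eq.congr_left hright

end Turakainen

/-! ### Quantum automata are real automata -/

namespace KWQFA

variable {α Q : Type*} [Fintype Q] [DecidableEq Q] (M : KWQFA α Q)

/-- The matrix that first evolves by `M.trans σ` and then projects onto the non-halting states. -/
def nonhaltingTrans (σ : TapeSymbol α) : Matrix Q Q ℂ :=
  Matrix.diagonal (fun q => if q ∈ M.accept ∪ M.reject then 0 else 1) * M.trans σ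

theorem nonhaltingTrans_mulVec (σ : TapeSymbol α) (u : Q → ℂ) :
    M.nonhaltingTrans σ *ᵥ u = M.dropHalting (M.trans σ *ᵥ u) := by
  ext q
  rw [nonhaltingTrans, ← Matrix.mulVec_mulVec, Matrix.mulVec_diagonal]
  simp [dropHalting]

/-- One step of the automaton on pairs of an unnormalized density matrix and an accumulated
acceptance probability. -/
def densityStep (σ : TapeSymbol α) : Matrix Q Q ℂ × ℝ →ₗ[ℝ] Matrix Q Q ℂ × ℝ where
  toFun x := (M.nonhaltingTrans σ * x.1 * (M.nonhaltingTrans σ)ᴴ,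
    x.2 + ∑ q ∈ M.accept, ((M.trans σ * x.1 * (M.trans σ)ᴴ) q q).re)
  map_add' x y := by
    ext1
    · simp [mul_add, add_mul]
    · simp [mul_add, add_mul, Finset.sum_add_distrib]
      ring
  map_smul' r x := by
    ext1
    · simp
    · simp [Finset.mul_sum, mul_add]

theorem mul_vecMulVec_star_mul {Q : Type*} [Fintype Q] (U : Matrix Q Q ℂ) (u : Q → ℂ) :
    U * Matrix.vecMulVec u (star u) * Uᴴ = Matrix.vecMulVec (U *ᵥ u) (star (U *ᵥ u)) := by
  rw [Matrix.mul_vecMulVec, Matrix.vecMulVec_mul, Matrix.star_mulVec]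

theorem foldl_densityStep (x : List (TapeSymbol α)) (u : Q → ℂ) (p : ℝ) :
    (x.foldl (fun y σ => M.densityStep σ y) (Matrix.vecMulVec u (star u), p)).2 =
      p + M.acceptProbFrom u x := by
  induction x generalizing u p with
  | nil => simp [acceptProbFrom]
  | cons σ x ih =>
    have hstep : M.densityStep σ (Matrix.vecMulVec u (star u), p) =
        (Matrix.vecMulVec (M.dropHalting (M.trans σ *ᵥ u))
          (star (M.dropHalting (M.trans σ *ᵥ u))),
          p + ∑ q ∈ M.accept, ‖(M.trans σ *ᵥ u) q‖ ^ 2) := by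
      simp only [densityStep, LinearMap.coe_mk, AddHom.coe_mk, mul_vecMulVec_star_mul,
        nonhaltingTrans_mulVec, Prod.mk.injEq, true_and, add_right_inj]
      refine Finset.sum_congr rfl fun q _ => ?_
      rw [Matrix.vecMulVec_apply, Pi.star_apply, RCLike.star_def, Complex.mul_conj,
        Complex.ofReal_re, Complex.normSq_eq_norm_sq]
    rw [List.foldl_cons, hstep, ih, acceptProbFrom, add_assoc]

theorem setOf_acceptProb_eq_one_mem_SEq {α : Type*} {Q : Type} [Fintype Q] [DecidableEq Q]
    (M : KWQFA α Q) : eqCutLanguage M.acceptProb 1 ∈ SEq α := by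
  refine Set.mem_of_eq_of_mem ?_ (setOf_linear_eq_zero_mem_SEq M.densityStep
    (Matrix.vecMulVec (Pi.single M.start 1) (star (Pi.single M.start 1)), -1)
    (LinearMap.snd ℝ (Matrix Q Q ℂ) ℝ))
  ext w
  change M.acceptProb w = 1 ↔ Prod.snd _ = 0
  rw [foldl_densityStep, neg_add_eq_zero, eq_comm]
  rfl

end KWQFA

/-! ### Real automata are quantum automata -/

section Dilation

variable {S : Type*} [Fintype S] [DecidableEq S]

open scoped Matrix.Norms.L2Operator MatrixOrder in
/-- A small multiple of any square matrix is a contraction, so it has a complement that makes the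
two of them together an isometry. -/
theorem exists_smul_conjTranspose_mul_add_eq_one (B : Matrix S S ℂ) :
    ∃ c : ℝ, 0 < c ∧ ∃ D : Matrix S S ℂ, (c • B)ᴴ * (c • B) + Dᴴ * D = 1 := by
  refine ⟨(1 + ‖B‖)⁻¹, by positivity, ?_⟩
  set c : ℝ := (1 + ‖B‖)⁻¹ with hc
  have hcB : ‖c • B‖ ≤ 1 := by
    rw [norm_smul, hc, Real.norm_of_nonneg (by positivity), inv_mul_le_iff₀ (by positivity)]
    linarith
  have hle : (c • B)ᴴ * (c • B) ≤ 1 := by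
    refine (CStarAlgebra.star_mul_le_algebraMap_norm_sq (a := c • B)).trans ?_
    rw [← map_one (algebraMap ℝ (Matrix S S ℂ))]
    exact algebraMap_mono _ (pow_le_one₀ (norm_nonneg _) hcB)
  obtain ⟨D, hD⟩ := CStarAlgebra.nonneg_iff_eq_star_mul_self.1 (sub_nonneg.2 hle)
  exact ⟨D, by rw [← Matrix.star_eq_conjTranspose D, ← hD]; abel⟩

/-- A sufficiently small positive multiple of any square matrix is a corner of a unitary matrix. -/
theorem exists_unitary_corner (B : Matrix S S ℂ) :
    ∃ c : ℝ, 0 < c ∧ ∃ U ∈ Matrix.unitaryGroup (S ⊕ S) ℂ,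
      ∀ i j, U (Sum.inl i) (Sum.inl j) = c * B i j := by
  obtain ⟨c, hc, D, hD⟩ := exists_smul_conjTranspose_mul_add_eq_one B
  refine ⟨c, hc, ?_⟩
  -- The columns of the isometry with blocks `c • B` and `D`, extended to an orthonormal basis.
  let v : S ⊕ S → EuclideanSpace ℂ (S ⊕ S) :=
    Sum.elim (fun j => WithLp.toLp 2 (Sum.elim (fun i => (c • B) i j) (fun i => D i j))) 0
  have hv : Orthonormal ℂ ((Set.range (Sum.inl : S → S ⊕ S)).domRestrict v) := by
    rw [orthonormal_iff_ite]
    rintro ⟨_, j, rfl⟩ ⟨_, k, rfl⟩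
    have h := congrFun (congrFun hD j) k
    simp only [Matrix.add_apply, Matrix.mul_apply, Matrix.conjTranspose_apply, Matrix.one_apply]
      at h
    simp only [Set.domRestrict_apply, v, Sum.elim_inl, EuclideanSpace.inner_eq_star_dotProduct,
      dotProduct, Fintype.sum_sum_type, Sum.elim_inr, Pi.star_apply]
    refine Eq.trans ?_ (h.trans <| if_congr
      ⟨fun e => by subst e; rfl, fun e => Sum.inl_injective (congrArg Subtype.val e)⟩ rfl rfl)
    simp only [mul_comm]
  obtain ⟨b, hb⟩ := hv.exists_orthonormalBasis_extension_of_card_eq (by simp)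
  refine ⟨(EuclideanSpace.basisFun (S ⊕ S) ℂ).toBasis.toMatrix b,
    (EuclideanSpace.basisFun (S ⊕ S) ℂ).toMatrix_orthonormalBasis_mem_unitary b, fun i j => ?_⟩
  rw [Module.Basis.toMatrix_apply, hb _ ⟨j, rfl⟩]
  simp [v]

theorem sum_norm_sq_mulVec_of_mem_unitaryGroup {Q : Type*} [Fintype Q] [DecidableEq Q]
    {U : Matrix Q Q ℂ} (hU : U ∈ Matrix.unitaryGroup Q ℂ) (u : Q → ℂ) :
    ∑ q, ‖(U *ᵥ u) q‖ ^ 2 = ∑ q, ‖u q‖ ^ 2 := by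
  have key (z : Q → ℂ) : ((∑ q, ‖z q‖ ^ 2 : ℝ) : ℂ) = star z ⬝ᵥ z := by
    simp [dotProduct, RCLike.star_def, Complex.conj_mul']
  rw [← Complex.ofReal_inj, key, key, Matrix.star_mulVec, ← Matrix.dotProduct_mulVec,
    Matrix.mulVec_mulVec, ← Matrix.star_eq_conjTranspose, Matrix.mem_unitaryGroup_iff'.1 hU,
    Matrix.one_mulVec]

end Dilation

namespace KWQFA

variable {α S : Type*} [Fintype S] [DecidableEq S]

/-- If the second half of the states of `M` accepts, nothing rejects and the first half evolves by
real matrices, then whatever leaves the first half is accepted. -/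
theorem acceptProbFrom_eq_sub (M : KWQFA α (S ⊕ S))
    (hacc : M.accept = Finset.univ.map ⟨Sum.inr, Sum.inr_injective⟩) (hrej : M.reject = ∅)
    (A : TapeSymbol α → Matrix S S ℝ)
    (hA : ∀ σ i j, M.trans σ (Sum.inl i) (Sum.inl j) = (A σ j i : ℂ))
    (x : List (TapeSymbol α)) (v : S → ℝ) :
    M.acceptProbFrom (Sum.elim (fun i => (v i : ℂ)) 0) x =
      ∑ i, v i ^ 2 - ∑ i, rowRun A v x i ^ 2 := by
  induction x generalizing v with
  | nil => simp [acceptProbFrom]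
  | cons σ x ih =>
    have hinl (i : S) : (M.trans σ *ᵥ Sum.elim (fun i => (v i : ℂ)) 0) (Sum.inl i) =
        ((v ᵥ* A σ) i : ℝ) := by
      simp [Matrix.mulVec, Matrix.vecMul, dotProduct, hA, mul_comm]
    have hdrop : M.dropHalting (M.trans σ *ᵥ Sum.elim (fun i => (v i : ℂ)) 0) =
        Sum.elim (fun i => ((v ᵥ* A σ) i : ℂ)) 0 := by
      ext (i | i)
      · simp [dropHalting, hacc, hrej, hinl]
      · simp [dropHalting, hacc, hrej]
    have hnorm := sum_norm_sq_mulVec_of_mem_unitaryGroup (M.trans_unitary σ)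
      (Sum.elim (fun i => (v i : ℂ)) 0)
    simp only [Fintype.sum_sum_type, hinl, Sum.elim_inl, Sum.elim_inr, Complex.norm_real,
      Real.norm_eq_abs, sq_abs, Pi.zero_apply, norm_zero, ne_eq, OfNat.ofNat_ne_zero,
      not_false_eq_true, zero_pow, Finset.sum_const_zero, add_zero] at hnorm
    rw [acceptProbFrom, hdrop, ih, hacc, Finset.sum_map, rowRun_cons]
    simp only [Function.Embedding.coeFn_mk]
    linarith

end KWQFA

/-- The set of the words that lead a real automaton to the zero vector is recognized with negative
one-sided error by a quantum automaton. -/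
theorem setOf_rowRun_eq_zero_mem_KWQFANegativeOneSided {α : Type*} {n : Type} [Fintype n]
    [DecidableEq n] (M : TapeSymbol α → Matrix n n ℝ) (i : n) :
    ({w | rowRun M (Pi.single i 1) (tape w) = 0} : Language α) ∈ KWQFANegativeOneSided α := by
  choose c hc U hU hUM using fun σ => exists_unitary_corner ((M σ)ᵀ.map ((↑) : ℝ → ℂ))
  refine ⟨n ⊕ n, inferInstance, inferInstance,
    ⟨Sum.inl i, U, hU, Finset.univ.map ⟨Sum.inr, Sum.inr_injective⟩, ∅, by simp⟩, ?_⟩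
  ext w
  obtain ⟨k, hk, hkM⟩ := exists_rowRun_smul_eq M hc (tape w)
  change rowRun M (Pi.single i 1) (tape w) = 0 ↔ KWQFA.acceptProbFrom _ (Pi.single (Sum.inl i) 1) _ = 1
  have hstart : (Pi.single (Sum.inl i) 1 : n ⊕ n → ℂ) =
      Sum.elim (fun j => ((Pi.single i 1 : n → ℝ) j : ℂ)) 0 := by
    ext (j | j)
    · by_cases h : j = i <;> simp [Pi.single_apply, h]
    · simp
  rw [hstart, KWQFA.acceptProbFrom_eq_sub _ rfl rfl (fun σ => c σ • M σ)
    (fun σ i j => by simp [hUM]), hkM]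
  have hone : ∑ j, (Pi.single i 1 : n → ℝ) j ^ 2 = 1 := by
    simp [Pi.single_apply]
  rw [hone, sub_eq_self, Finset.sum_eq_zero_iff_of_nonneg fun _ _ => sq_nonneg _]
  simp [hk.ne', funext_iff]

/-! ### Probabilistic automata with a cut point are real automata -/

theorem PFA.eqCutLanguage_mem_KWQFANegativeOneSided {α : Type*} {S : Type} [Fintype S]
    [DecidableEq S] (P : PFA α S) (c : ℝ) :
    eqCutLanguage P.acceptProb c ∈ KWQFANegativeOneSided α := by
  -- Distributions have total mass one, so subtracting `c` from every row sum over the accepting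
  -- states subtracts `c` from the acceptance probability.
  let M : TapeSymbol α → Matrix S S ℝ
    | .rightEnd => Matrix.of fun i _ => ∑ k ∈ P.accept, P.trans .rightEnd i k - c
    | σ => P.trans σ
  refine Set.mem_of_eq_of_mem ?_ (setOf_rowRun_eq_zero_mem_KWQFANegativeOneSided M P.start)
  ext w
  have hletters (v : S → ℝ) (w : List α) :
      rowRun M v (w.map TapeSymbol.letter) = rowRun P.trans v (w.map TapeSymbol.letter) := by
    simp only [rowRun, List.foldl_map, M]
  have hrun : rowRun M (Pi.single P.start 1) (tape w) = fun _ => P.acceptProb w - c := by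
    change _ = fun _ => (∑ i ∈ P.accept, rowRun P.trans (Pi.single P.start 1) (tape w) i) - c
    have hmass := sum_rowRun_of_rowStochastic P.trans_stochastic
      (TapeSymbol.leftEnd :: w.map TapeSymbol.letter) (Pi.single P.start 1)
    rw [tape_eq_concat, rowRun_concat, rowRun_concat, rowRun_cons, hletters, ← rowRun_cons]
    set v := rowRun P.trans (Pi.single P.start 1)
      (TapeSymbol.leftEnd :: w.map TapeSymbol.letter)
    rw [Finset.sum_pi_single', if_pos (Finset.mem_univ _)] at hmass
    ext j
    simp only [M, Matrix.vecMul, dotProduct, Matrix.of_apply, mul_sub, Finset.sum_sub_distrib,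
      ← Finset.sum_mul, hmass, one_mul, Finset.mul_sum]
    rw [Finset.sum_comm]
  change P.acceptProb w = c ↔ rowRun M (Pi.single P.start 1) (tape w) = 0
  have : Nonempty S := ⟨P.start⟩
  simp [hrun, funext_iff, sub_eq_zero]

theorem corollary3p5 (α : Type*) [Finite α] : SEq α = KWQFANegativeOneSided α := by
  ext L
  constructor
  · rintro ⟨S, _, _, P, c, -, rfl⟩
    exact P.eqCutLanguage_mem_KWQFANegativeOneSided c
  · rintro ⟨Q, _, _, M, rfl⟩
    exact M.setOf_acceptProb_eq_one_mem_SEq
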